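/- **Notation.** Let $\langle x,x^*\rangle$ be the monoid of words in the $2g$ free letters $x_1,\dots,x_g,x_1^*,\dots,x_g^*$, and let $\mathbb R\langle x,x^*\rangle$ be its real monoid algebra with the $\mathbb R$-linear involution $(pq)^*=q^*p^*$ exchanging $x_i$ and $x_i^*$; let $\mathbb R\langle x,x^*\rangle_1$ be the subspace of polynomials of degree at most $1$. $\mathbb R^{a\times b}\langle x,x^*\rangle$ denotes the $a\times b$ matrices over $\mathbb R\langle x,x^*\rangle$, with $(p^*)_{ij}=(p_{ji})^*$; $p$ is symmetric if $p^*=p$. For $X\in(\mathbb R^{n\times n})^g$, a polynomial is evaluated by $x_i\mapsto X_i$, $x_i^*\mapsto X_i^{T}$, and a matrix $p=\sum_w A_w\otimes w$ by $p(X)=\sum_w A_w\otimes w(X)$. Products of sets denote linear spans of products. A *linear pencil* is a symmetric $L\in\mathbb R^{\nu\times\nu}\langle x,x^*\rangle$ of degree at most $1$. A *left module* is a left $\mathbb R\langle x,x^*\rangle$-submodule $I$ of the space of rows $\mathbb R^{1\times\ell}\langle x,x^*\rangle$ (with entrywise left multiplication), and $V(I)$ is the set of all $(X,v)\in(\mathbb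 R^{n\times n})^g\times\mathbb R^{\ell n}$, $n\in\mathbb N$, with $\iota(X)v=0$ for all $\iota\in I$. A *right chip space* is a subspace $\mathfrak C\subseteq\mathbb R^{1\times\ell}\langle x,x^*\rangle$ spanned by a set of monomials $e_i\otimes w$ such that $e_i\otimes w_1w_2w_3,\ e_i\otimes w_3\in\mathfrak C$ imply $e_i\otimes w_2w_3\in\mathfrak C$. It is *finite* if it is finite dimensional, and *full* if $e_i\otimes uw\in\mathfrak C$ implies $e_i\otimes w\in\mathfrak C$ for all words $u,w$. A left module $J$ is *$(L,\mathfrak C)$-real* if, whenever $\sum_i p_i^*p_i+\sum_j q_j^*Lq_j\in\mathbb R^{\ell\times1}J+J^*\mathbb R^{1\times\ell}$ (finite sums) with $p_i\in\mathfrak C$ and $q_j\in\mathbb R^{\nu\times1}\mathfrak C$, then each $p_i\in J$ and each $Lq_j\in\mathbb R^{\nu\times1}J$; it is *strongly $(L,\mathfrak C)$-real* if the conclusion is instead that each $p_i\in J$ and each $q_j\in\mathbb R^{\nu\times1}J$. The *$(L,\mathfrak C)$-real radical* (respectively *strong $(L,\mathfrak C)$-real radical*) of $I$ is the intersection of all $(L,\mathfrak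 C)$-real (respectively strongly $(L,\mathfrak C)$-real) left modules containing $I$. **Theorem.** Let $L\in\mathbb R^{\nu\times\nu}\langle x,x^*\rangle$ be a linear pencil, let $\mathfrak C\subseteq\mathbb R^{1\times\ell}\langle x,x^*\rangle$ be a full, finite right chip space, let $I\subseteq\mathbb R^{1\times\ell}\langle x,x^*\rangle$ be a left module generated by elements of $\mathbb R\langle x,x^*\rangle_1\mathfrak C$, and let $p\in\mathfrak C^*\mathbb R\langle x,x^*\rangle_1\mathfrak C$ be symmetric. 1. $v^*p(X)v\ge0$ for all $(X,v)\in V(I)$ with $L(X)\succeq0$ if and only if $$p=\sum_i p_i^*p_i+\sum_j q_j^*Lq_j+\sum_k\bigl(r_k^*\iota_k+\iota_k^*r_k\bigr)\qquad(\dagger)$$ (finite sums) with all $p_i,r_k\in\mathfrak C$, all $q_j\in\mathbb R^{\nu\times1}\mathfrak C$, and all $\iota_k\in\mathbb R\langle x,x^*\rangle_1\mathfrak C$ lying in the $(L,\mathfrak C)$-real radical of $I$. 2. $v^*p(X)v\ge0$ for all $(X,v)\in V(I)$ with $L(X)\succ0$ if and only if $p$ has the form $(\dagger)$ with all $p_i,r_k\in\mathfrak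 C$, all $q_j\in\mathbb R^{\nu\times1}\mathfrak C$, and all $\iota_k\in\mathbb R\langle x,x^*\rangle_1\mathfrak C$ lying in the strong $(L,\mathfrak C)$-real radical of $I$. -/

import Mathlib

open scoped Matrix

noncomputable section

/-- Real noncommutative polynomials in the `2g` free letters
`x_1, …, x_g` (`Sum.inl`) and `x_1^*, …, x_g^*` (`Sum.inr`). -/
abbrev NCPoly (g : ℕ) : Type := FreeAlgebra ℝ (Fin g ⊕ Fin g)

/-- `a × b` matrices of noncommutative polynomials. -/
abbrev NCMat (g a b : ℕ) : Type := Matrix (Fin a) (Fin b) (NCPoly g)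

/-- Rows `1 × ℓ` of noncommutative polynomials. -/
abbrev NCRow (g ℓ : ℕ) : Type := NCMat g 1 ℓ

/-- A word in the letters, as a polynomial. -/
def ncWord {g : ℕ} (w : List (Fin g ⊕ Fin g)) : NCPoly g :=
  (w.map (FreeAlgebra.ι ℝ)).prod

/-- The involution on noncommutative polynomials: the `ℝ`-linear anti-automorphism that
exchanges `x_i` and `x_i^*`. (Mathlib's `star` on `FreeAlgebra` fixes the letters and is
not the one wanted here.) -/
def ncAdj {g : ℕ} (p : NCPoly g) : NCPoly g :=
  MulOpposite.unop
    (FreeAlgebra.lift ℝ (fun s : Fin g ⊕ Fin g => MulOpposite.op (FreeAlgebra.ι ℝ s.swap)) p)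

/-- The involution on matrices of polynomials: transpose, with the involution in each entry. -/
def ncMatAdj {g a b : ℕ} (p : NCMat g a b) : NCMat g b a :=
  (p.map ncAdj)ᵀ

/-- Evaluation of a polynomial at a tuple of real matrices: `x_i ↦ X_i`, `x_i^* ↦ X_iᵀ`. -/
def ncEval {g n : ℕ} (X : Fin g → Matrix (Fin n) (Fin n) ℝ) :
    NCPoly g →ₐ[ℝ] Matrix (Fin n) (Fin n) ℝ :=
  FreeAlgebra.lift ℝ (Sum.elim X (fun i => (X i)ᵀ))

/-- Evaluation of a matrix of polynomials, as the block matrix whose `(i, j)` block is the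
value of the `(i, j)` entry, i.e. `∑_w A_w ⊗ w(X)`. -/
def ncMatEval {g n a b : ℕ} (X : Fin g → Matrix (Fin n) (Fin n) ℝ) (p : NCMat g a b) :
    Matrix (Fin a × Fin n) (Fin b × Fin n) ℝ :=
  Matrix.comp _ _ _ _ _ (p.map (ncEval X))

/-- Polynomials of degree at most `d`. -/
def ncDegLE (g d : ℕ) : Submodule ℝ (NCPoly g) :=
  Submodule.span ℝ {p | ∃ w : List (Fin g ⊕ Fin g), w.length ≤ d ∧ p = ncWord w}

/-- A linear pencil: a symmetric square matrix polynomial of degree at most one. -/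
structure IsLinearPencil {g ν : ℕ} (L : NCMat g ν ν) : Prop where
  symm : ncMatAdj L = L
  deg_le_one : ∀ i j, L i j ∈ ncDegLE g 1

/-- The monomial `e_i ⊗ w` in the space of rows. -/
def rowMonomial {g ℓ : ℕ} (i : Fin ℓ) (w : List (Fin g ⊕ Fin g)) : NCRow g ℓ :=
  Matrix.single 0 i (ncWord w)

/-- Right chip spaces. -/
structure IsRightChipSpace {g ℓ : ℕ} (C : Submodule ℝ (NCRow g ℓ)) : Prop where
  spanned : ∃ S : Set (Fin ℓ × List (Fin g ⊕ Fin g)),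
    C = Submodule.span ℝ ((fun m => rowMonomial m.1 m.2) '' S)
  chip : ∀ (i : Fin ℓ) (w₁ w₂ w₃ : List (Fin g ⊕ Fin g)),
    rowMonomial i (w₁ ++ w₂ ++ w₃) ∈ C → rowMonomial i w₃ ∈ C →
      rowMonomial i (w₂ ++ w₃) ∈ C

/-- A right chip space is full if it contains all right chips of its monomials. -/
def IsFullChipSpace {g ℓ : ℕ} (C : Submodule ℝ (NCRow g ℓ)) : Prop :=
  ∀ (i : Fin ℓ) (u w : List (Fin g ⊕ Fin g)),
    rowMonomial i (u ++ w) ∈ C → rowMonomial i w ∈ C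

/-- The space `ℝ⟨x, x^*⟩_1 C`. -/
def degOneMul {g ℓ : ℕ} (C : Submodule ℝ (NCRow g ℓ)) : Submodule ℝ (NCRow g ℓ) :=
  Submodule.span ℝ {r | ∃ a ∈ ncDegLE g 1, ∃ c ∈ C, r = a • c}

/-- The space `C^* ℝ⟨x, x^*⟩_1 C` of `ℓ × ℓ` matrix polynomials. -/
def adjDegOneMul {g ℓ : ℕ} (C : Submodule ℝ (NCRow g ℓ)) : Submodule ℝ (NCMat g ℓ ℓ) :=
  Submodule.span ℝ {r | ∃ b ∈ C, ∃ d ∈ degOneMul C, r = ncMatAdj b * d}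

/-- The space `ℝ^{a × 1} W`, for a space `W` of rows: the `a × ℓ` matrices all of whose rows
lie in `W`. -/
def MemRows {g a ℓ : ℕ} (W : Submodule ℝ (NCRow g ℓ)) (q : NCMat g a ℓ) : Prop :=
  ∀ i : Fin a, (Matrix.of fun _ j => q i j : NCRow g ℓ) ∈ W

/-- A left module, as a real vector space of rows. -/
abbrev realSpace {g ℓ : ℕ} (I : Submodule (NCPoly g) (NCRow g ℓ)) :
    Submodule ℝ (NCRow g ℓ) :=
  I.restrictScalars ℝ

/-- Membership in `ℝ^{ℓ × 1} I + I^* ℝ^{1 × ℓ}`. -/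
def MemSymmSum {g ℓ : ℕ} (I : Submodule (NCPoly g) (NCRow g ℓ)) (r : NCMat g ℓ ℓ) : Prop :=
  ∃ a b : NCMat g ℓ ℓ, MemRows (realSpace I) a ∧ MemRows (realSpace I) b ∧
    r = a + ncMatAdj b

/-- `(L, C)`-real left modules. -/
def IsLCReal {g ν ℓ : ℕ} (L : NCMat g ν ν) (C : Submodule ℝ (NCRow g ℓ))
    (I : Submodule (NCPoly g) (NCRow g ℓ)) : Prop :=
  ∀ (s t : ℕ) (p : Fin s → NCRow g ℓ) (q : Fin t → NCMat g ν ℓ),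
    (∀ i, p i ∈ C) → (∀ j, MemRows C (q j)) →
    MemSymmSum I (∑ i, ncMatAdj (p i) * p i + ∑ j, ncMatAdj (q j) * L * q j) →
    (∀ i, p i ∈ I) ∧ (∀ j, MemRows (realSpace I) (L * q j))

/-- Strongly `(L, C)`-real left modules. -/
def IsStronglyLCReal {g ν ℓ : ℕ} (L : NCMat g ν ν) (C : Submodule ℝ (NCRow g ℓ))
    (I : Submodule (NCPoly g) (NCRow g ℓ)) : Prop :=
  ∀ (s t : ℕ) (p : Fin s → NCRow g ℓ) (q : Fin t → NCMat g ν ℓ),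
    (∀ i, p i ∈ C) → (∀ j, MemRows C (q j)) →
    MemSymmSum I (∑ i, ncMatAdj (p i) * p i + ∑ j, ncMatAdj (q j) * L * q j) →
    (∀ i, p i ∈ I) ∧ (∀ j, MemRows (realSpace I) (q j))

/-- The `(L, C)`-real radical of a left module. -/
def lcRadical {g ν ℓ : ℕ} (L : NCMat g ν ν) (C : Submodule ℝ (NCRow g ℓ))
    (I : Submodule (NCPoly g) (NCRow g ℓ)) : Submodule (NCPoly g) (NCRow g ℓ) :=
  sInf {J | I ≤ J ∧ IsLCReal L C J}

/-- The strong `(L, C)`-real radical of a left module. -/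
def lcStrongRadical {g ν ℓ : ℕ} (L : NCMat g ν ν) (C : Submodule ℝ (NCRow g ℓ))
    (I : Submodule (NCPoly g) (NCRow g ℓ)) : Submodule (NCPoly g) (NCRow g ℓ) :=
  sInf {J | I ≤ J ∧ IsStronglyLCReal L C J}

/-- `(X, v) ∈ V(I)`: every row in `I`, evaluated at `X`, annihilates `v`. -/
def MemZeroSet {g ℓ n : ℕ} (I : Submodule (NCPoly g) (NCRow g ℓ))
    (X : Fin g → Matrix (Fin n) (Fin n) ℝ) (v : Fin ℓ × Fin n → ℝ) : Prop :=
  ∀ r ∈ I, ncMatEval X r *ᵥ v = 0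

/-- `p = ∑ p_i^* p_i + ∑ q_j^* L q_j + ∑ (r_k^* ι_k + ι_k^* r_k)` with `p_i, r_k ∈ C`,
`q_j ∈ ℝ^{ν × 1} C` and `ι_k ∈ J ∩ ℝ⟨x, x^*⟩_1 C`. -/
def HasCertificate {g ν ℓ : ℕ} (L : NCMat g ν ν) (C : Submodule ℝ (NCRow g ℓ))
    (J : Submodule (NCPoly g) (NCRow g ℓ)) (f : NCMat g ℓ ℓ) : Prop :=
  ∃ (s t u : ℕ) (p : Fin s → NCRow g ℓ) (q : Fin t → NCMat g ν ℓ)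
    (r h : Fin u → NCRow g ℓ),
    (∀ i, p i ∈ C) ∧ (∀ j, MemRows C (q j)) ∧ (∀ k, r k ∈ C) ∧
    (∀ k, h k ∈ J ∧ h k ∈ degOneMul C) ∧
    f = ∑ i, ncMatAdj (p i) * p i + ∑ j, ncMatAdj (q j) * L * q j
      + ∑ k, (ncMatAdj (r k) * h k + ncMatAdj (h k) * r k)

end

/-! Soundness. The rows annihilating `v` at `X` form a left module. It is `(L, C)`-real when `L(X)`
is positive semidefinite, and strongly so when `L(X)` is positive definite. If `(X, v)` lies in
`V(I)`, this module therefore contains the corresponding radical of `I`, and the terms `r^* h + h^*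
r` of a certificate contribute nothing at `(X, v)`.

Completeness. Let `J` be the radical and suppose `p` has no certificate. Modulo the symmetric span
of products `r^* h` with `h ∈ J` of the allowed degree, the sums of `a^* a + q^* L q` form a cone
missing `p`. Reality of `J` says that such a sum vanishes modulo this span only if every pair `(a,
q)` is degenerate. Hence `exists_separating` yields a functional that is zero on the span, negative
at `p` and strictly positive on every nondegenerate pair.

A GNS construction (`exists_gns`) turns the functional into matrices `X` and a vector `v` with `v^*
f(X) v = φ(f)` on `C^* ℝ⟨x, x^*⟩_1 C`. Every vector is some `a(X) v` with `a ∈ C`, so positivity on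
the terms `q^* L q` becomes positivity of `L(X)`, while `v^* p(X) v < 0`. The two statements differ
only in which pairs count as degenerate: `a ∈ J` with the rows of `L q` in `J`, or with those of `q`
itself in `J`. -/

noncomputable section

/-! ### The involution -/

section Involution

variable {g : ℕ}

@[simp] lemma ncAdj_zero : ncAdj (0 : NCPoly g) = 0 := by simp [ncAdj]

@[simp] lemma ncAdj_one : ncAdj (1 : NCPoly g) = 1 := by simp [ncAdj]

@[simp] lemma ncAdj_add (p q : NCPoly g) : ncAdj (p + q) = ncAdj p + ncAdj q := by
  simp [ncAdj]

@[simp] lemma ncAdj_smul (c : ℝ) (p : NCPoly g) : ncAdj (c • p) = c • ncAdj p := by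
  simp [ncAdj]

@[simp] lemma ncAdj_mul (p q : NCPoly g) : ncAdj (p * q) = ncAdj q * ncAdj p := by
  simp [ncAdj]

@[simp] lemma ncAdj_algebraMap (c : ℝ) :
    ncAdj (algebraMap ℝ (NCPoly g) c) = algebraMap ℝ (NCPoly g) c := by
  rw [Algebra.algebraMap_eq_smul_one, ncAdj_smul, ncAdj_one]

@[simp] lemma ncAdj_letter (s : Fin g ⊕ Fin g) :
    ncAdj (FreeAlgebra.ι ℝ s) = FreeAlgebra.ι ℝ s.swap := by simp [ncAdj]

@[simp] lemma ncAdj_ncAdj (p : NCPoly g) : ncAdj (ncAdj p) = p := by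
  induction p using FreeAlgebra.induction with
  | grade0 c => simp
  | grade1 s => simp
  | mul a b ha hb => simp [ha, hb]
  | add a b ha hb => simp [ha, hb]

/-- The involution as a real linear map. -/
def ncAdjLin (g : ℕ) : NCPoly g →ₗ[ℝ] NCPoly g where
  toFun := ncAdj
  map_add' := ncAdj_add
  map_smul' := ncAdj_smul

lemma ncAdj_sum {ι : Type*} (s : Finset ι) (f : ι → NCPoly g) :
    ncAdj (∑ i ∈ s, f i) = ∑ i ∈ s, ncAdj (f i) :=
  map_sum (ncAdjLin g) f s

lemma ncEval_ncAdj {n : ℕ} (X : Fin g → Matrix (Fin n) (Fin n) ℝ) (p : NCPoly g) :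
    ncEval X (ncAdj p) = (ncEval X p)ᵀ := by
  induction p using FreeAlgebra.induction with
  | grade0 c =>
    rw [ncAdj_algebraMap, AlgHom.commutes, Matrix.algebraMap_eq_diagonal,
      Matrix.diagonal_transpose]
  | grade1 s => cases s <;> simp [ncEval]
  | mul a b ha hb => simp [ha, hb, Matrix.transpose_mul]
  | add a b ha hb => simp [ha, hb]

variable {a b c : ℕ}

@[simp] lemma ncMatAdj_apply (p : NCMat g a b) (i : Fin b) (j : Fin a) :
    ncMatAdj p i j = ncAdj (p j i) := rfl

/-- The involution on matrices of polynomials as a real linear map. -/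
def ncMatAdjLin (g a b : ℕ) : NCMat g a b →ₗ[ℝ] NCMat g b a where
  toFun := ncMatAdj
  map_add' p q := by ext i j; simp
  map_smul' t p := by ext i j; simp

lemma ncMatAdj_add (p q : NCMat g a b) : ncMatAdj (p + q) = ncMatAdj p + ncMatAdj q :=
  map_add (ncMatAdjLin g a b) p q

lemma ncMatAdj_smul (t : ℝ) (p : NCMat g a b) : ncMatAdj (t • p) = t • ncMatAdj p :=
  map_smul (ncMatAdjLin g a b) t p

lemma ncMatAdj_sum {ι : Type*} (s : Finset ι) (f : ι → NCMat g a b) :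
    ncMatAdj (∑ i ∈ s, f i) = ∑ i ∈ s, ncMatAdj (f i) :=
  map_sum (ncMatAdjLin g a b) f s

@[simp] lemma ncMatAdj_ncMatAdj (p : NCMat g a b) : ncMatAdj (ncMatAdj p) = p := by
  ext i j; simp

lemma ncMatAdj_mul (p : NCMat g a b) (q : NCMat g b c) :
    ncMatAdj (p * q) = ncMatAdj q * ncMatAdj p := by
  ext i j; simp [Matrix.mul_apply, ncAdj_sum]

end Involution

/-! ### Rows of matrix polynomials -/

section Rows

variable {g a b ℓ : ℕ}

/-- The `i`-th row of a matrix polynomial. -/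
def ncRowOf (M : NCMat g a ℓ) (i : Fin a) : NCRow g ℓ := Matrix.of fun _ j => M i j

@[simp] lemma ncRowOf_apply (M : NCMat g a ℓ) (i : Fin a) (k : Fin 1) (j : Fin ℓ) :
    ncRowOf M i k j = M i j := rfl

lemma ncRowOf_mul (L : NCMat g a b) (q : NCMat g b ℓ) (i : Fin a) :
    ncRowOf (L * q) i = ∑ j, L i j • ncRowOf q j := by
  ext k j
  simp [Matrix.mul_apply, Matrix.sum_apply]

lemma ncMatAdj_mul_eq_sum (A : NCMat g a b) (B : NCMat g a ℓ) :
    ncMatAdj A * B = ∑ i, ncMatAdj (ncRowOf A i) * ncRowOf B i := by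
  ext k j
  simp [Matrix.mul_apply, Matrix.sum_apply]

lemma ncRowOf_adj_mul (r : NCRow g a) (h : NCRow g ℓ) (i : Fin a) :
    ncRowOf (ncMatAdj r * h) i = ncAdj (r 0 i) • h := by
  ext k j
  simp [Matrix.mul_apply, Subsingleton.elim k 0]

lemma ncMatAdj_mul_smul (r : NCRow g a) (h : NCRow g ℓ) (x : NCPoly g) :
    ncMatAdj r * (x • h) = ncMatAdj (ncAdj x • r) * h := by
  ext i j
  simp [Matrix.mul_apply, mul_assoc]

lemma ncMatAdj_smul_mul (r : NCRow g a) (h : NCRow g ℓ) (x : NCPoly g) :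
    ncMatAdj (x • r) * h = ncMatAdj r * (ncAdj x • h) := by
  rw [ncMatAdj_mul_smul, ncAdj_ncAdj]

end Rows

/-! ### Evaluation, quadratic forms and annihilators -/

section Evaluation

variable {g n a b c ℓ : ℕ} (X : Fin g → Matrix (Fin n) (Fin n) ℝ)

@[simp] lemma ncMatEval_apply (p : NCMat g a b) (i : Fin a × Fin n) (j : Fin b × Fin n) :
    ncMatEval X p i j = ncEval X (p i.1 j.1) i.2 j.2 := rfl

/-- Evaluation of matrix polynomials as a real linear map. -/
def ncMatEvalLin (a b : ℕ) :
    NCMat g a b →ₗ[ℝ] Matrix (Fin a × Fin n) (Fin b × Fin n) ℝ where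
  toFun := ncMatEval X
  map_add' p q := by ext i j; simp
  map_smul' t p := by ext i j; simp

lemma ncMatEval_mul (p : NCMat g a b) (q : NCMat g b c) :
    ncMatEval X (p * q) = ncMatEval X p * ncMatEval X q := by
  ext i j
  simp [Matrix.mul_apply, Matrix.sum_apply, Fintype.sum_prod_type]

lemma ncMatEval_ncMatAdj (p : NCMat g a b) :
    ncMatEval X (ncMatAdj p) = (ncMatEval X p)ᵀ := by
  ext i j
  simp [ncEval_ncAdj]

/-- The quadratic form `v^* p(X) v` is linear in `p`. -/
def ncQuadLin (v : Fin ℓ × Fin n → ℝ) : NCMat g ℓ ℓ →ₗ[ℝ] ℝ where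
  toFun p := v ⬝ᵥ (ncMatEval X p *ᵥ v)
  map_add' p q := by
    rw [show ncMatEval X (p + q) = ncMatEval X p + ncMatEval X q from
      map_add (ncMatEvalLin X ℓ ℓ) p q, Matrix.add_mulVec, dotProduct_add]
  map_smul' t p := by
    rw [show ncMatEval X (t • p) = t • ncMatEval X p from
      map_smul (ncMatEvalLin X ℓ ℓ) t p, Matrix.smul_mulVec, dotProduct_smul]
    rfl

lemma ncQuadLin_apply (v : Fin ℓ × Fin n → ℝ) (p : NCMat g ℓ ℓ) :
    ncQuadLin X v p = v ⬝ᵥ (ncMatEval X p *ᵥ v) := rfl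

lemma ncQuadLin_adj_mul (v : Fin ℓ × Fin n → ℝ) (A B : NCMat g a ℓ) :
    ncQuadLin X v (ncMatAdj A * B) =
      (ncMatEval X A *ᵥ v) ⬝ᵥ (ncMatEval X B *ᵥ v) := by
  rw [ncQuadLin_apply, ncMatEval_mul, ncMatEval_ncMatAdj, ← Matrix.mulVec_mulVec,
    Matrix.dotProduct_mulVec, Matrix.vecMul_transpose]

lemma ncQuadLin_adj_mul_mul (v : Fin ℓ × Fin n → ℝ) (L : NCMat g a a) (q : NCMat g a ℓ) :
    ncQuadLin X v (ncMatAdj q * L * q) =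
      (ncMatEval X q *ᵥ v) ⬝ᵥ (ncMatEval X L *ᵥ (ncMatEval X q *ᵥ v)) := by
  rw [Matrix.mul_assoc, ncQuadLin_adj_mul, ncMatEval_mul, Matrix.mulVec_mulVec]

lemma ncQuadLin_ncMatAdj (v : Fin ℓ × Fin n → ℝ) (p : NCMat g ℓ ℓ) :
    ncQuadLin X v (ncMatAdj p) = ncQuadLin X v p := by
  rw [ncQuadLin_apply, ncMatEval_ncMatAdj, Matrix.mulVec_transpose, dotProduct_comm,
    ← Matrix.dotProduct_mulVec, ncQuadLin_apply]

/-- The value `r(X) v` of a row of polynomials, as a linear function of the row. -/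
def rowVal (v : Fin ℓ × Fin n → ℝ) : NCRow g ℓ →ₗ[ℝ] (Fin n → ℝ) where
  toFun r k := (ncMatEval X r *ᵥ v) (0, k)
  map_add' p q := by
    rw [show ncMatEval X (p + q) = ncMatEval X p + ncMatEval X q from
      map_add (ncMatEvalLin X 1 ℓ) p q, Matrix.add_mulVec]
    rfl
  map_smul' t p := by
    rw [show ncMatEval X (t • p) = t • ncMatEval X p from
      map_smul (ncMatEvalLin X 1 ℓ) t p, Matrix.smul_mulVec]
    rfl

lemma rowVal_apply (v : Fin ℓ × Fin n → ℝ) (r : NCRow g ℓ) (k : Fin n) :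
    rowVal X v r k = (ncMatEval X r *ᵥ v) (0, k) := rfl

lemma ncMatEval_mulVec_apply (v : Fin ℓ × Fin n → ℝ) (M : NCMat g a ℓ) (i : Fin a)
    (k : Fin n) : (ncMatEval X M *ᵥ v) (i, k) = rowVal X v (ncRowOf M i) k := rfl

lemma rowVal_smul (v : Fin ℓ × Fin n → ℝ) (x : NCPoly g) (r : NCRow g ℓ) :
    rowVal X v (x • r) = ncEval X x *ᵥ rowVal X v r := by
  ext k
  simp only [rowVal_apply, Matrix.mulVec, dotProduct, ncMatEval_apply, Matrix.smul_apply,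
    smul_eq_mul, map_mul, Matrix.mul_apply, Finset.sum_mul, Finset.mul_sum]
  rw [Finset.sum_comm]
  simp only [mul_assoc]

lemma ncMatEval_mulVec_eq_zero_iff (v : Fin ℓ × Fin n → ℝ) (M : NCMat g a ℓ) :
    ncMatEval X M *ᵥ v = 0 ↔ ∀ i, rowVal X v (ncRowOf M i) = 0 := by
  constructor
  · intro h i
    ext k
    rw [← ncMatEval_mulVec_apply, h]; rfl
  · intro h
    ext ⟨i, k⟩
    rw [ncMatEval_mulVec_apply, h]; rfl

lemma ncRowOf_row (r : NCRow g ℓ) (i : Fin 1) : ncRowOf r i = r := by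
  ext k j
  rw [ncRowOf_apply, Subsingleton.elim i k]

lemma ncMatEval_row_mulVec_eq_zero_iff (v : Fin ℓ × Fin n → ℝ) (r : NCRow g ℓ) :
    ncMatEval X r *ᵥ v = 0 ↔ rowVal X v r = 0 := by
  simp [ncMatEval_mulVec_eq_zero_iff, ncRowOf_row]

/-- The left module of rows of polynomials annihilating `v` at `X`. -/
def annihilator (v : Fin ℓ × Fin n → ℝ) : Submodule (NCPoly g) (NCRow g ℓ) where
  carrier := {r | rowVal X v r = 0}
  add_mem' {r s} hr hs := by
    simp only [Set.mem_ofPred_eq] at *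
    rw [map_add, hr, hs, add_zero]
  zero_mem' := map_zero _
  smul_mem' x r hr := by
    simp only [Set.mem_ofPred_eq] at *
    rw [rowVal_smul, hr, Matrix.mulVec_zero]

lemma mem_annihilator {v : Fin ℓ × Fin n → ℝ} {r : NCRow g ℓ} :
    r ∈ annihilator X v ↔ rowVal X v r = 0 := Iff.rfl

lemma memZeroSet_iff (v : Fin ℓ × Fin n → ℝ) (I : Submodule (NCPoly g) (NCRow g ℓ)) :
    MemZeroSet I X v ↔ I ≤ annihilator X v := by
  simp only [MemZeroSet, ncMatEval_row_mulVec_eq_zero_iff]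
  rfl

lemma memRows_annihilator_iff (v : Fin ℓ × Fin n → ℝ) (M : NCMat g a ℓ) :
    MemRows (realSpace (annihilator X v)) M ↔ ncMatEval X M *ᵥ v = 0 := by
  rw [ncMatEval_mulVec_eq_zero_iff]; rfl

end Evaluation

/-! ### Soundness of certificates -/

section Soundness

variable {g n ν ℓ : ℕ} (X : Fin g → Matrix (Fin n) (Fin n) ℝ) (v : Fin ℓ × Fin n → ℝ)
  {L : NCMat g ν ν} {C : Submodule ℝ (NCRow g ℓ)}

lemma ncQuadLin_eq_zero_of_memSymmSum {f : NCMat g ℓ ℓ}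
    (hf : MemSymmSum (annihilator X v) f) : ncQuadLin X v f = 0 := by
  obtain ⟨a, b, ha, hb, rfl⟩ := hf
  rw [memRows_annihilator_iff] at ha hb
  rw [map_add, ncQuadLin_ncMatAdj, ncQuadLin_apply, ncQuadLin_apply, ha, hb]
  simp

lemma ncQuadLin_adj_mul_self_nonneg (r : NCRow g ℓ) :
    0 ≤ ncQuadLin X v (ncMatAdj r * r) := by
  rw [ncQuadLin_adj_mul]
  exact Finset.sum_nonneg fun i _ => mul_self_nonneg _

lemma ncQuadLin_pencil_nonneg (hL : (ncMatEval X L).PosSemidef) (q : NCMat g ν ℓ) :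
    0 ≤ ncQuadLin X v (ncMatAdj q * L * q) := by
  rw [ncQuadLin_adj_mul_mul]
  simpa using hL.dotProduct_mulVec_nonneg (ncMatEval X q *ᵥ v)

/-- The quadratic form at `v` kills the whole sum, yet every summand is nonnegative there, so each
one vanishes. For the pencil terms, `wᵀ L(X) w = 0` forces `L(X) w = 0` by semidefiniteness. -/
lemma eval_eq_zero_of_memSymmSum_annihilator (hL : (ncMatEval X L).PosSemidef) {s t : ℕ}
    {p : Fin s → NCRow g ℓ} {q : Fin t → NCMat g ν ℓ}
    (h : MemSymmSum (annihilator X v)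
      (∑ i, ncMatAdj (p i) * p i + ∑ j, ncMatAdj (q j) * L * q j)) :
    (∀ i, p i ∈ annihilator X v) ∧
      ∀ j, ncMatEval X L *ᵥ (ncMatEval X (q j) *ᵥ v) = 0 := by
  have h0 := ncQuadLin_eq_zero_of_memSymmSum X v h
  rw [map_add, map_sum, map_sum] at h0
  have hp := fun i => ncQuadLin_adj_mul_self_nonneg X v (p i)
  have hq := fun j => ncQuadLin_pencil_nonneg X v hL (q j)
  have h1 := Finset.sum_nonneg fun i (_ : i ∈ Finset.univ) => hp i
  have h2 := Finset.sum_nonneg fun i (_ : i ∈ Finset.univ) => hq i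
  have hp0 := (Finset.sum_eq_zero_iff_of_nonneg fun i _ => hp i).1
    (le_antisymm (by linarith) h1)
  have hq0 := (Finset.sum_eq_zero_iff_of_nonneg fun i _ => hq i).1
    (le_antisymm (by linarith) h2)
  constructor
  · intro i
    have := hp0 i (Finset.mem_univ _)
    rw [ncQuadLin_adj_mul, dotProduct_self_eq_zero] at this
    rwa [mem_annihilator, ← ncMatEval_row_mulVec_eq_zero_iff]
  · intro j
    have := hq0 j (Finset.mem_univ _)
    rw [ncQuadLin_adj_mul_mul] at this
    exact (hL.dotProduct_mulVec_zero_iff _).1 (by simpa using this)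

lemma isLCReal_annihilator (hL : (ncMatEval X L).PosSemidef) :
    IsLCReal L C (annihilator X v) := by
  intro s t p q _ _ h
  obtain ⟨h1, h2⟩ := eval_eq_zero_of_memSymmSum_annihilator X v hL h
  refine ⟨h1, fun j => ?_⟩
  rw [memRows_annihilator_iff, ncMatEval_mul, ← Matrix.mulVec_mulVec, h2]

lemma isStronglyLCReal_annihilator (hL : (ncMatEval X L).PosDef) :
    IsStronglyLCReal L C (annihilator X v) := by
  intro s t p q _ _ h
  obtain ⟨h1, h2⟩ := eval_eq_zero_of_memSymmSum_annihilator X v hL.posSemidef h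
  refine ⟨h1, fun j => ?_⟩
  rw [memRows_annihilator_iff]
  by_contra hne
  have := hL.dotProduct_mulVec_pos hne
  rw [h2] at this
  simp at this

lemma nonneg_of_hasCertificate (hL : (ncMatEval X L).PosSemidef)
    {J : Submodule (NCPoly g) (NCRow g ℓ)} (hJ : J ≤ annihilator X v) {f : NCMat g ℓ ℓ}
    (hf : HasCertificate L C J f) : 0 ≤ v ⬝ᵥ (ncMatEval X f *ᵥ v) := by
  obtain ⟨s, t, u, p, q, r, h, -, -, -, hh, rfl⟩ := hf
  rw [← ncQuadLin_apply, map_add, map_add, map_sum, map_sum, map_sum]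
  have h3 : ∀ k, ncQuadLin X v (ncMatAdj (r k) * h k + ncMatAdj (h k) * r k) = 0 := by
    intro k
    have : ncMatEval X (h k) *ᵥ v = 0 :=
      (ncMatEval_row_mulVec_eq_zero_iff X v _).2 (hJ (hh k).1)
    rw [map_add, ncQuadLin_adj_mul, ncQuadLin_adj_mul, this]
    simp
  have h1 := Finset.sum_nonneg fun i (_ : i ∈ Finset.univ) =>
    ncQuadLin_adj_mul_self_nonneg X v (p i)
  have h2 := Finset.sum_nonneg fun i (_ : i ∈ Finset.univ) =>
    ncQuadLin_pencil_nonneg X v hL (q i)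
  simp only [h3, Finset.sum_const_zero]
  linarith

end Soundness

/-! ### The radicals are themselves real -/

section Radical

variable {g ν ℓ : ℕ} (L : NCMat g ν ν) (C : Submodule ℝ (NCRow g ℓ))
  (I : Submodule (NCPoly g) (NCRow g ℓ))

lemma le_lcRadical : I ≤ lcRadical L C I := le_sInf fun _ h => h.1

lemma le_lcStrongRadical : I ≤ lcStrongRadical L C I := le_sInf fun _ h => h.1

lemma MemSymmSum.mono {I J : Submodule (NCPoly g) (NCRow g ℓ)} (h : I ≤ J)
    {f : NCMat g ℓ ℓ} (hf : MemSymmSum I f) : MemSymmSum J f := by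
  obtain ⟨a, b, ha, hb, hab⟩ := hf
  exact ⟨a, b, fun i => h (ha i), fun i => h (hb i), hab⟩

/-- Reality passes to intersections: its hypothesis for the intersection implies that for each
member, and its conclusions are memberships. -/
lemma isLCReal_lcRadical : IsLCReal L C (lcRadical L C I) := by
  intro s t p q hp hq h
  have key : ∀ J ∈ {J | I ≤ J ∧ IsLCReal L C J}, _ := fun J hJ =>
    hJ.2 s t p q hp hq (h.mono (sInf_le hJ))
  exact ⟨fun i => Submodule.mem_sInf.2 fun J hJ => (key J hJ).1 i,
    fun j k => Submodule.mem_sInf.2 fun J hJ => (key J hJ).2 j k⟩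

lemma isStronglyLCReal_lcStrongRadical : IsStronglyLCReal L C (lcStrongRadical L C I) := by
  intro s t p q hp hq h
  have key : ∀ J ∈ {J | I ≤ J ∧ IsStronglyLCReal L C J}, _ := fun J hJ =>
    hJ.2 s t p q hp hq (h.mono (sInf_le hJ))
  exact ⟨fun i => Submodule.mem_sInf.2 fun J hJ => (key J hJ).1 i,
    fun j k => Submodule.mem_sInf.2 fun J hJ => (key J hJ).2 j k⟩

end Radical

/-! ### Convex separation and orthonormalisation -/

section Separation

/-- In finite dimension, convex hulls of compact sets are compact. -/
lemma isCompact_convexHull_of_finiteDimensional {E : Type*} [NormedAddCommGroup E]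
    [NormedSpace ℝ E] [FiniteDimensional ℝ E] {s : Set E} (hs : IsCompact s) :
    IsCompact (convexHull ℝ s) := by
  -- Carathéodory: at most `finrank + 1` points are needed, so the hull is a finite union of
  -- continuous images of compact sets.
  have key : convexHull ℝ s = ⋃ k ∈ Finset.range (Module.finrank ℝ E + 2),
      (fun x : (Fin k → ℝ) × (Fin k → E) => ∑ i, x.1 i • x.2 i) ''
        (stdSimplex ℝ (Fin k) ×ˢ Set.univ.pi fun _ => s) := by
    apply Set.Subset.antisymm
    · intro x hx
      obtain ⟨ι, _, z, w, hz, hind, hw, hw1, hx⟩ := eq_pos_convex_span_of_mem_convexHull hx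
      have hcard := hind.card_le_finrank_succ
      have hle : Module.finrank ℝ (vectorSpan ℝ (Set.range z)) ≤ Module.finrank ℝ E :=
        Submodule.finrank_le _
      refine Set.mem_biUnion (x := Fintype.card ι)
        (by simp only [Finset.coe_range, Set.mem_Iio]; omega) ?_
      let e := Fintype.equivFin ι
      refine ⟨(w ∘ e.symm, z ∘ e.symm), ⟨⟨fun i => (hw _).le, ?_⟩,
        fun i _ => hz ⟨_, rfl⟩⟩, ?_⟩
      · rw [← hw1]; exact e.symm.sum_comp w
      · rw [← hx]; exact e.symm.sum_comp fun i => w i • z i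
    · refine Set.iUnion₂_subset fun k _ => ?_
      rintro _ ⟨⟨w, z⟩, ⟨hw, hz⟩, rfl⟩
      exact mem_convexHull_of_exists_fintype w z hw.1 hw.2 (fun i => hz i trivial) rfl
  rw [key]
  refine Finset.isCompact_biUnion _ fun k _ => IsCompact.image ?_ (by fun_prop)
  exact (isCompact_stdSimplex ℝ _).prod (isCompact_univ_pi fun _ => hs)

lemma exists_linearMap_pos_of_zero_notMem_convexHull {E : Type*} [NormedAddCommGroup E]
    [NormedSpace ℝ E] [FiniteDimensional ℝ E] {s : Set E} (hs : IsCompact s)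
    (h0 : (0 : E) ∉ convexHull ℝ s) : ∃ φ : E →ₗ[ℝ] ℝ, ∀ x ∈ s, 0 < φ x := by
  obtain ⟨φ, u, h1, h2⟩ := geometric_hahn_banach_point_closed (convex_convexHull ℝ s)
    (isCompact_convexHull_of_finiteDimensional hs).isClosed h0
  refine ⟨φ.toLinearMap, fun x hx => ?_⟩
  have := h2 x (subset_convexHull ℝ s hx)
  rw [map_zero] at h1
  exact h1.trans this

variable {E F : Type*} [AddCommGroup E] [Module ℝ E] [AddCommGroup F] [Module ℝ F]

lemma sum_diag_smul (B : F →ₗ[ℝ] F →ₗ[ℝ] E) {a : ℝ} (ha : 0 ≤ a) {n : ℕ} (f : Fin n → F) :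
    ∑ i, B (√a • f i) (√a • f i) = a • ∑ i, B (f i) (f i) := by
  simp [Finset.smul_sum, smul_smul, Real.mul_self_sqrt ha]

/-- Differences of a sum of values of a quadratic map and a nonnegative multiple of `p`, at least
one of which is nontrivial. -/
def diagCone (B : F →ₗ[ℝ] F →ₗ[ℝ] E) (K : Submodule ℝ F) (p : E) : Set E :=
  {z | ∃ (n : ℕ) (f : Fin n → F) (s : ℝ), 0 ≤ s ∧ z = ∑ i, B (f i) (f i) - s • p ∧
    (0 < s ∨ ∃ i, f i ∉ K)}

lemma convex_diagCone (B : F →ₗ[ℝ] F →ₗ[ℝ] E) (K : Submodule ℝ F) (p : E) :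
    Convex ℝ (diagCone B K p) := by
  rw [convex_iff_forall_pos]
  rintro _ ⟨n, f, s, hs, rfl, h⟩ _ ⟨m, f', s', hs', rfl, -⟩ a b ha hb -
  refine ⟨n + m, Fin.append (fun i => √a • f i) (fun i => √b • f' i), a * s + b * s',
    by positivity, ?_, ?_⟩
  · simp only [Fin.sum_univ_add, Fin.append_left, Fin.append_right, sum_diag_smul B ha.le,
      sum_diag_smul B hb.le]
    module
  · rcases h with h | ⟨i, hi⟩
    · exact Or.inl (by positivity)
    · refine Or.inr ⟨Fin.castAdd m i, ?_⟩
      rw [Fin.append_left]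
      rwa [K.smul_mem_iff (Real.sqrt_pos.2 ha).ne']

/-- If `s > 0`, dividing by `s` exhibits `p` as a sum of diagonal values. If `s = 0`, a sum of
diagonal values is zero and every `f i` is in `K`. -/
lemma zero_notMem_diagCone {B : F →ₗ[ℝ] F →ₗ[ℝ] E} {K : Submodule ℝ F} {p : E}
    (hreal : ∀ (n : ℕ) (f : Fin n → F), ∑ i, B (f i) (f i) = 0 → ∀ i, f i ∈ K)
    (hp : ∀ (n : ℕ) (f : Fin n → F), p ≠ ∑ i, B (f i) (f i)) :
    (0 : E) ∉ diagCone B K p := by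
  rintro ⟨n, f, s, hs, h0, h⟩
  rcases hs.eq_or_lt with rfl | hs
  · obtain h | ⟨i, hi⟩ := h
    · exact h.false
    · exact hi (hreal n f (by rw [zero_smul, sub_zero] at h0; exact h0.symm) i)
  · refine hp n (fun i => √s⁻¹ • f i) ?_
    rw [sum_diag_smul B (inv_nonneg.2 hs.le), sub_eq_zero.1 h0.symm, smul_smul,
      inv_mul_cancel₀ hs.ne', one_smul]

lemma continuous_diag_pi {k m : ℕ} (B : (Fin k → ℝ) →ₗ[ℝ] (Fin k → ℝ) →ₗ[ℝ] (Fin m → ℝ)) :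
    Continuous fun t => B t t := by
  have : (fun t => B t t) = fun t : Fin k → ℝ => ∑ i, t i • B (Pi.single i 1) t := by
    ext1 t
    conv_lhs => rw [LinearMap.pi_apply_eq_sum_univ B t]
    rw [LinearMap.sum_apply]
    refine Finset.sum_congr rfl fun i _ => ?_
    rw [LinearMap.smul_apply]
    congr 3
    ext j
    simp [Pi.single_apply, eq_comm]
  rw [this]
  refine continuous_finsetSum _ fun i _ => (continuous_apply i).smul ?_
  exact LinearMap.continuous_of_finiteDimensional _

/-- Closedness of the cone is never needed. It suffices to separate `0` from the convex hull of a
compact set of generators, namely `-p` and the values on the unit sphere; this hull lies inside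
`diagCone`, which misses `0`. -/
lemma exists_linearMap_pos_of_injective {m k : ℕ} {B : F →ₗ[ℝ] F →ₗ[ℝ] (Fin m → ℝ)}
    {K : Submodule ℝ F} {p : Fin m → ℝ} (par : (Fin k → ℝ) →ₗ[ℝ] F)
    (hpar : ∀ t, par t ∈ K → t = 0)
    (hreal : ∀ (n : ℕ) (f : Fin n → F), ∑ i, B (f i) (f i) = 0 → ∀ i, f i ∈ K)
    (hp : ∀ (n : ℕ) (f : Fin n → F), p ≠ ∑ i, B (f i) (f i)) :
    ∃ φ : (Fin m → ℝ) →ₗ[ℝ] ℝ, (∀ t ≠ 0, 0 < φ (B (par t) (par t))) ∧ φ p < 0 := by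
  let T : Set (Fin m → ℝ) :=
    insert (-p) ((fun t => B (par t) (par t)) '' Metric.sphere (0 : Fin k → ℝ) 1)
  have hT : IsCompact T :=
    ((isCompact_sphere _ _).image (continuous_diag_pi (B.compl₁₂ par par))).insert _
  have hTG : T ⊆ diagCone B K p := by
    rintro z (rfl | ⟨t, ht, rfl⟩)
    · exact ⟨0, Fin.elim0, 1, zero_le_one, by simp, Or.inl one_pos⟩
    · refine ⟨1, fun _ => par t, 0, le_rfl, by simp, Or.inr ⟨0, fun h => ?_⟩⟩
      rw [hpar t h] at ht
      simp at ht
  obtain ⟨φ, hφ⟩ := exists_linearMap_pos_of_zero_notMem_convexHull hT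
    fun h => zero_notMem_diagCone hreal hp (convexHull_min hTG (convex_diagCone B K p) h)
  refine ⟨φ, fun t ht => ?_, ?_⟩
  · have hn : 0 < ‖t‖ := norm_pos_iff.2 ht
    -- Positivity on the sphere extends to all `t ≠ 0` because `B` is quadratic on the diagonal.
    have h1 := hφ _ (Or.inr ⟨‖t‖⁻¹ • t, by simp [norm_smul, hn.ne'], rfl⟩)
    simp only [map_smul, LinearMap.smul_apply, smul_eq_mul] at h1
    have h2 := mul_pos (mul_pos hn hn) h1
    have h3 : ‖t‖ * ‖t‖ * (‖t‖⁻¹ * (‖t‖⁻¹ * φ (B (par t) (par t)))) = φ (B (par t) (par t)) := by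
      field_simp
    rwa [h3] at h2
  · simpa using hφ _ (Or.inl rfl)

/-- Separation from the cone of sums of values of a quadratic map, by a functional which is
positive off the degenerate subspace `K`. -/
lemma exists_separating_of_forall_ne [FiniteDimensional ℝ F] {B : F →ₗ[ℝ] F →ₗ[ℝ] E}
    {K : Submodule ℝ F} {p : E} (hl : ∀ k ∈ K, ∀ f, B k f = 0) (hr : ∀ k ∈ K, ∀ f, B f k = 0)
    (hreal : ∀ (n : ℕ) (f : Fin n → F), ∑ i, B (f i) (f i) = 0 → ∀ i, f i ∈ K)
    (hp : ∀ (n : ℕ) (f : Fin n → F), p ≠ ∑ i, B (f i) (f i)) :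
    ∃ φ : E →ₗ[ℝ] ℝ, (∀ f ∉ K, 0 < φ (B f f)) ∧ φ p < 0 := by
  -- `E` may be infinite dimensional; everything relevant lives in this finite dimensional subspace.
  let R : Submodule ℝ E := LinearMap.range (TensorProduct.lift B) ⊔ Submodule.span ℝ {p}
  have hBR : ∀ f f', B f f' ∈ R := fun f f' =>
    Submodule.mem_sup_left ⟨f ⊗ₜ f', TensorProduct.lift.tmul _ _⟩
  have hpR : p ∈ R := Submodule.mem_sup_right (Submodule.mem_span_singleton_self p)
  -- Since `B` vanishes against `K`, its diagonal depends only on the component in a complement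
  -- `K'`, where nonzero vectors avoid `K`.
  obtain ⟨K', hK'⟩ := K.exists_isCompl
  let ψ := (Module.finBasis ℝ R).equivFun
  let e := (Module.finBasis ℝ K').equivFun
  let par := K'.subtype ∘ₗ e.symm.toLinearMap
  have hpar : ∀ t, par t ∈ K → t = 0 := fun t ht => by
    have h0 : par t = 0 := (Submodule.disjoint_def.1 hK'.disjoint) _ ht (e.symm t).2
    have h1 : e.symm t = 0 := Subtype.ext h0
    simpa using h1
  let BR : F →ₗ[ℝ] F →ₗ[ℝ] R := LinearMap.mk₂ ℝ (fun f f' => ⟨B f f', hBR f f'⟩)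
    (fun _ _ _ => Subtype.ext (by simp)) (fun _ _ _ => Subtype.ext (by simp))
    (fun _ _ _ => Subtype.ext (by simp)) (fun _ _ _ => Subtype.ext (by simp))
  have hBRc : ∀ f f', (BR f f' : E) = B f f' := fun _ _ => rfl
  have hsum : ∀ (n : ℕ) (f : Fin n → F) (z : R),
      ψ z = ∑ i, BR.compr₂ ψ.toLinearMap (f i) (f i) → (z : E) = ∑ i, B (f i) (f i) := by
    intro n f z h
    have h' : ψ z = ψ (∑ i, BR (f i) (f i)) := by rw [h, map_sum]; rfl
    rw [ψ.injective h', Submodule.coe_sum]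
    rfl
  obtain ⟨φ, h1, h2⟩ := exists_linearMap_pos_of_injective (B := BR.compr₂ ψ.toLinearMap)
    (K := K) (p := ψ ⟨p, hpR⟩) par hpar
    (fun n f h => hreal n f (hsum n f 0 (by rw [map_zero, h])).symm)
    (fun n f h => hp n f (hsum n f _ h))
  obtain ⟨φ', hφ'⟩ := LinearMap.exists_extend (φ ∘ₗ ψ.toLinearMap)
  have hφ'R : ∀ z : R, φ' z = φ (ψ z) := fun z => LinearMap.congr_fun hφ' z
  refine ⟨φ', fun f hf => ?_, ?_⟩
  · obtain ⟨a, ha, b, hb, rfl⟩ := Submodule.mem_sup.1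
      ((hK'.sup_eq_top ▸ Submodule.mem_top : f ∈ K ⊔ K'))
    have hB : B (a + b) (a + b) = B b b := by
      rw [map_add B, LinearMap.add_apply, hl a ha, zero_add, map_add, hr a ha, zero_add]
    have hb0 : e ⟨b, hb⟩ ≠ 0 := by
      intro h
      have : (⟨b, hb⟩ : K') = 0 := by simpa using h
      have hb' : b = 0 := congrArg Subtype.val this
      exact hf (by rw [hb', add_zero]; exact ha)
    have h3 := h1 _ hb0
    have h4 : par (e ⟨b, hb⟩) = b := by simp [par]
    rw [h4] at h3
    rw [hB, ← hBRc, hφ'R]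
    exact h3
  · have := hφ'R ⟨p, hpR⟩
    simp only at this
    rwa [this]

/-- Passing to the quotient by `U` reduces this to `exists_separating_of_forall_ne`. -/
lemma exists_separating [FiniteDimensional ℝ F] {B : F →ₗ[ℝ] F →ₗ[ℝ] E}
    {K : Submodule ℝ F} {U : Submodule ℝ E} {p : E}
    (hl : ∀ k ∈ K, ∀ f, B k f ∈ U) (hr : ∀ k ∈ K, ∀ f, B f k ∈ U)
    (hreal : ∀ (n : ℕ) (f : Fin n → F), ∑ i, B (f i) (f i) ∈ U → ∀ i, f i ∈ K)
    (hp : ∀ (n : ℕ) (f : Fin n → F), p - ∑ i, B (f i) (f i) ∉ U) :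
    ∃ φ : E →ₗ[ℝ] ℝ, (∀ u ∈ U, φ u = 0) ∧ (∀ f ∉ K, 0 < φ (B f f)) ∧ φ p < 0 := by
  have hsum : ∀ (n : ℕ) (f : Fin n → F), ∑ i, B.compr₂ U.mkQ (f i) (f i) =
      U.mkQ (∑ i, B (f i) (f i)) := fun n f => by rw [map_sum]; rfl
  obtain ⟨φ, h1, h2⟩ := exists_separating_of_forall_ne (B := B.compr₂ U.mkQ) (K := K)
    (p := U.mkQ p) (fun k hk f => (Submodule.Quotient.mk_eq_zero U).2 (hl k hk f))
    (fun k hk f => (Submodule.Quotient.mk_eq_zero U).2 (hr k hk f))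
    (fun n f h => hreal n f (by
      rw [hsum] at h
      exact (Submodule.Quotient.mk_eq_zero U).1 h))
    (fun n f h => hp n f (by
      rw [hsum] at h
      exact (Submodule.Quotient.eq U).1 h))
  refine ⟨φ ∘ₗ U.mkQ, fun u hu => ?_, h1, h2⟩
  rw [LinearMap.comp_apply, Submodule.mkQ_apply, (Submodule.Quotient.mk_eq_zero U).2 hu,
    map_zero]

/-- A positive semidefinite form on a finite dimensional space has a finite orthonormal family that
spans modulo the isotropic vectors. -/
lemma exists_orthonormal_modulo_isotropic [FiniteDimensional ℝ F]
    {B : LinearMap.BilinForm ℝ F} (hB : ∀ x y, B x y = B y x) (hpos : ∀ f, 0 ≤ B f f) :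
    ∃ (n : ℕ) (c : Fin n → F), (∀ k l, B (c k) (c l) = if k = l then 1 else 0) ∧
      ∀ f, B (f - ∑ k, B (c k) f • c k) (f - ∑ k, B (c k) f • c k) = 0 := by
  obtain ⟨v, hv⟩ := LinearMap.BilinForm.exists_orthogonal_basis (B := B) ⟨hB⟩
  let P := {i // B (v i) (v i) ≠ 0}
  -- Cauchy–Schwarz: isotropic vectors lie in the kernel of the form.
  have hcs : ∀ x y, B x x = 0 → B x y = 0 := by
    intro x y hx
    have := LinearMap.BilinForm.apply_mul_apply_le_of_forall_zero_le B hpos x y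
    rw [hx, zero_mul, hB y x] at this
    nlinarith
  let b : P → F := fun i => (√(B (v i) (v i)))⁻¹ • v i
  have hb : ∀ i j : P, B (b i) (b j) = if i = j then 1 else 0 := by
    intro i j
    simp only [b, map_smul, LinearMap.smul_apply, smul_eq_mul]
    split_ifs with h
    · subst h
      have h1 : 0 < B (v i) (v i) := lt_of_le_of_ne (hpos _) (Ne.symm i.2)
      have h2 := Real.mul_self_sqrt h1.le
      have h3 := (Real.sqrt_pos.2 h1).ne'
      field_simp
      rw [sq, h2]
    · have : B (v i) (v j) = 0 := hv (fun h' => h (Subtype.ext h'))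
      simp [this]
  let N : Submodule ℝ F := LinearMap.ker B
  have hmem : ∀ f, f ∈ N ⊔ Submodule.span ℝ (Set.range b) := by
    intro f
    have : Submodule.span ℝ (Set.range v) ≤ N ⊔ Submodule.span ℝ (Set.range b) := by
      rw [Submodule.span_le]
      rintro _ ⟨i, rfl⟩
      by_cases hi : B (v i) (v i) = 0
      · exact Submodule.mem_sup_left (LinearMap.ext fun y => hcs _ y hi)
      · refine Submodule.mem_sup_right ?_
        have h1 : 0 < B (v i) (v i) := lt_of_le_of_ne (hpos _) (Ne.symm hi)
        have h2 : v i = √(B (v i) (v i)) • b ⟨i, hi⟩ := by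
          simp [b, smul_smul, (Real.sqrt_pos.2 h1).ne']
        rw [h2]
        exact Submodule.smul_mem _ _ (Submodule.subset_span ⟨_, rfl⟩)
    exact this (v.span_eq ▸ Submodule.mem_top)
  have hres : ∀ f, f - ∑ k, B (b k) f • b k ∈ N := by
    intro f
    obtain ⟨x, hx, y, hy, rfl⟩ := Submodule.mem_sup.1 (hmem f)
    obtain ⟨a, rfl⟩ := (Submodule.mem_span_range_iff_exists_fun ℝ).1 hy
    have h1 : ∀ k, B (b k) (x + ∑ i, a i • b i) = a k := by
      intro k
      have h2 : B (b k) x = 0 := by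
        rw [hB (b k) x, LinearMap.mem_ker.1 hx]; rfl
      simp [h2, hb]
    simpa [h1] using hx
  let e := Fintype.equivFin P
  refine ⟨Fintype.card P, b ∘ e.symm, fun k l => ?_, fun f => ?_⟩
  · simp [hb]
  · have h1 : ∑ k, B ((b ∘ e.symm) k) f • (b ∘ e.symm) k = ∑ k, B (b k) f • b k :=
      e.symm.sum_comp fun k => B (b k) f • b k
    rw [h1, LinearMap.mem_ker.1 (hres f)]
    rfl

end Separation

/-! ### Degree bookkeeping for chip spaces -/

section ChipSpaces

variable {g ν a b ℓ : ℕ} {C : Submodule ℝ (NCRow g ℓ)}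

@[simp] lemma ncWord_nil : ncWord ([] : List (Fin g ⊕ Fin g)) = 1 := rfl

@[simp] lemma ncWord_cons (s : Fin g ⊕ Fin g) (w : List (Fin g ⊕ Fin g)) :
    ncWord (s :: w) = FreeAlgebra.ι ℝ s * ncWord w := by simp [ncWord]

lemma rowMonomial_cons (i : Fin ℓ) (s : Fin g ⊕ Fin g) (w : List (Fin g ⊕ Fin g)) :
    rowMonomial i (s :: w) = FreeAlgebra.ι ℝ s • rowMonomial i w := by
  simp [rowMonomial, Matrix.smul_single]

lemma one_mem_ncDegLE_one : (1 : NCPoly g) ∈ ncDegLE g 1 :=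
  Submodule.subset_span ⟨[], by simp, by simp⟩

lemma letter_mem_ncDegLE_one (s : Fin g ⊕ Fin g) : FreeAlgebra.ι ℝ s ∈ ncDegLE g 1 :=
  Submodule.subset_span ⟨[s], by simp, by simp⟩

lemma smul_mem_degOneMul {x : NCPoly g} (hx : x ∈ ncDegLE g 1) {c : NCRow g ℓ} (hc : c ∈ C) :
    x • c ∈ degOneMul C := Submodule.subset_span ⟨x, hx, c, hc, rfl⟩

lemma mem_degOneMul_of_mem {c : NCRow g ℓ} (hc : c ∈ C) : c ∈ degOneMul C := by
  simpa using smul_mem_degOneMul one_mem_ncDegLE_one hc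

lemma memRows_degOneMul_mul {L : NCMat g a b} (hL : ∀ i j, L i j ∈ ncDegLE g 1)
    {q : NCMat g b ℓ} (hq : MemRows C q) : MemRows (degOneMul C) (L * q) := by
  intro i
  change ncRowOf (L * q) i ∈ _
  rw [ncRowOf_mul]
  exact Submodule.sum_mem _ fun j _ => smul_mem_degOneMul (hL i j) (hq j)

lemma adj_mul_mem_adjDegOneMul {A B : NCMat g a ℓ} (hA : MemRows C A)
    (hB : MemRows (degOneMul C) B) : ncMatAdj A * B ∈ adjDegOneMul C := by
  rw [ncMatAdj_mul_eq_sum]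
  exact Submodule.sum_mem _ fun i _ => Submodule.subset_span ⟨_, hA i, _, hB i, rfl⟩

end ChipSpaces

/-! ### Cross terms and symmetrisation -/

section CrossTerms

variable {g ν a ℓ : ℕ}

/-- The span of the products `r^* h` with `r ∈ C` and `h ∈ J ∩ ℝ⟨x, x^*⟩_1 C`. -/
def crossSpan (C : Submodule ℝ (NCRow g ℓ)) (J : Submodule (NCPoly g) (NCRow g ℓ)) :
    Submodule ℝ (NCMat g ℓ ℓ) :=
  Submodule.span ℝ {f | ∃ r ∈ C, ∃ h ∈ J, h ∈ degOneMul C ∧ f = ncMatAdj r * h}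

/-- The symmetric span of the products `r^* h` and `h^* r`. -/
def symmCrossSpan (C : Submodule ℝ (NCRow g ℓ)) (J : Submodule (NCPoly g) (NCRow g ℓ)) :
    Submodule ℝ (NCMat g ℓ ℓ) :=
  crossSpan C J ⊔ (crossSpan C J).map (ncMatAdjLin g ℓ ℓ)

variable {C : Submodule ℝ (NCRow g ℓ)} {J : Submodule (NCPoly g) (NCRow g ℓ)}

lemma adj_mul_mem_crossSpan {A B : NCMat g a ℓ} (hA : MemRows C A)
    (hB : MemRows (degOneMul C) B) (hJ : MemRows (realSpace J) B) :
    ncMatAdj A * B ∈ crossSpan C J := by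
  rw [ncMatAdj_mul_eq_sum]
  exact Submodule.sum_mem _ fun i _ =>
    Submodule.subset_span ⟨_, hA i, _, hJ i, hB i, rfl⟩

lemma crossSpan_le_symmCrossSpan : crossSpan C J ≤ symmCrossSpan C J := le_sup_left

lemma adj_mem_symmCrossSpan {f : NCMat g ℓ ℓ} (hf : f ∈ crossSpan C J) :
    ncMatAdj f ∈ symmCrossSpan C J :=
  Submodule.mem_sup_right (Submodule.mem_map_of_mem hf)

lemma memRows_of_mem_crossSpan {f : NCMat g ℓ ℓ} (hf : f ∈ crossSpan C J) :
    MemRows (realSpace J) f := by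
  induction hf using Submodule.span_induction with
  | mem f h =>
    obtain ⟨r, -, h, hJ, -, rfl⟩ := h
    intro i
    change ncRowOf (ncMatAdj r * h) i ∈ J
    rw [ncRowOf_adj_mul]
    exact J.smul_mem _ hJ
  | zero => exact fun i => J.zero_mem
  | add x y _ _ hx hy => exact fun i => J.add_mem (hx i) (hy i)
  | smul t x _ hx => exact fun i => (realSpace J).smul_mem t (hx i)

/-- Rows of `r^* h` are left multiples of `h`, hence in `J`. This lets reality, stated without
degree bounds, be applied modulo the degree-bounded span. -/
lemma memSymmSum_of_mem_symmCrossSpan {f : NCMat g ℓ ℓ} (hf : f ∈ symmCrossSpan C J) :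
    MemSymmSum J f := by
  obtain ⟨d, hd, _, ⟨e, he, rfl⟩, rfl⟩ := Submodule.mem_sup.1 hf
  exact ⟨d, e, memRows_of_mem_crossSpan hd, memRows_of_mem_crossSpan he, rfl⟩

lemma exists_sum_of_mem_crossSpan {f : NCMat g ℓ ℓ} (hf : f ∈ crossSpan C J) :
    ∃ (u : ℕ) (r h : Fin u → NCRow g ℓ), (∀ k, r k ∈ C) ∧
      (∀ k, h k ∈ J ∧ h k ∈ degOneMul C) ∧ f = ∑ k, ncMatAdj (r k) * h k := by
  obtain ⟨u, t, x, rfl⟩ := Submodule.mem_span_set'.1 hf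
  choose r hr h hJ hC hx using fun k => (x k).2
  refine ⟨u, fun k => t k • r k, h, fun k => C.smul_mem _ (hr k),
    fun k => ⟨hJ k, hC k⟩, Finset.sum_congr rfl fun k _ => ?_⟩
  rw [hx, ncMatAdj_smul, Matrix.smul_mul]

/-- The difference has the form `d + e^*` and is symmetric, so averaging with its adjoint gives `c +
c^*` with `c = (d + e) / 2` in `crossSpan`. -/
lemma hasCertificate_of_sub_mem {L : NCMat g ν ν} (hL : ncMatAdj L = L) {f : NCMat g ℓ ℓ}
    (hf : ncMatAdj f = f) {n : ℕ} {p : Fin n → NCRow g ℓ} {q : Fin n → NCMat g ν ℓ}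
    (hp : ∀ i, p i ∈ C) (hq : ∀ i, MemRows C (q i))
    (h : f - ∑ i, (ncMatAdj (p i) * p i + ncMatAdj (q i) * L * q i) ∈ symmCrossSpan C J) :
    HasCertificate L C J f := by
  obtain ⟨d, hd, _, ⟨e, he, rfl⟩, hde⟩ := Submodule.mem_sup.1 h
  obtain ⟨u, r, k, hr, hk, hsum⟩ := exists_sum_of_mem_crossSpan
    (Submodule.smul_mem _ (1 / 2 : ℝ) (add_mem hd he))
  refine ⟨n, n, u, p, q, r, k, hp, hq, hr, hk, ?_⟩
  have h1 : ∑ j, (ncMatAdj (r j) * k j + ncMatAdj (k j) * r j) =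
      (1 / 2 : ℝ) • (d + e) + ncMatAdj ((1 / 2 : ℝ) • (d + e)) := by
    rw [hsum, ncMatAdj_sum, ← Finset.sum_add_distrib]
    simp only [ncMatAdj_mul, ncMatAdj_ncMatAdj]
  have h2 := congrArg ncMatAdj hde
  rw [show ncMatAdjLin g ℓ ℓ e = ncMatAdj e from rfl] at hde h2
  have h3 : ∀ x y : NCMat g ℓ ℓ, ncMatAdj (x - y) = ncMatAdj x - ncMatAdj y :=
    map_sub (ncMatAdjLin g ℓ ℓ)
  simp only [ncMatAdj_add, ncMatAdj_ncMatAdj, h3, ncMatAdj_sum, ncMatAdj_mul, hf, hL,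
    ← Matrix.mul_assoc] at h2
  rw [h1, ← Finset.sum_add_distrib, ncMatAdj_smul, ncMatAdj_add]
  rw [eq_sub_iff_add_eq] at hde h2
  have h4 := congrArg₂ (· + ·) hde h2
  have h5 : f = (1 / 2 : ℝ) • (f + f) := by module
  rw [h5, ← h4]
  module

end CrossTerms

/-! ### The GNS construction -/

section GNS

variable {g ν ℓ : ℕ} {C : Submodule ℝ (NCRow g ℓ)} {J : Submodule (NCPoly g) (NCRow g ℓ)}

lemma rowVal_rowMonomial_nil {n : ℕ} (X : Fin g → Matrix (Fin n) (Fin n) ℝ)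
    (v : Fin ℓ × Fin n → ℝ) (i : Fin ℓ) (k : Fin n) :
    rowVal X v (rowMonomial i []) k = v (i, k) := by
  simp only [rowVal_apply, Matrix.mulVec, dotProduct, ncMatEval_apply, rowMonomial, ncWord_nil,
    Fintype.sum_prod_type]
  rw [Finset.sum_eq_single i]
  · rw [Matrix.single_apply_same, map_one]
    simp [Matrix.one_apply]
  · intro j _ hj
    rw [Matrix.single_apply_of_col_ne _ _ hj.symm, map_zero]
    simp
  · simp

/-- The pairing of rows with `C` given by a functional, as a bilinear form on `C`. -/
def functionalForm (C : Submodule ℝ (NCRow g ℓ)) (φ : NCMat g ℓ ℓ →ₗ[ℝ] ℝ) :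
    LinearMap.BilinForm ℝ C :=
  LinearMap.mk₂ ℝ (fun a b => φ (ncMatAdj a.1 * b.1))
    (fun a b c => by simp [ncMatAdj_add, Matrix.add_mul])
    (fun t a b => by simp [ncMatAdj_smul])
    (fun a b c => by simp [Matrix.mul_add])
    (fun t a b => by simp)

/-- Coordinates of rows with respect to a finite family, given by a functional. -/
def functionalCoord {n : ℕ} (φ : NCMat g ℓ ℓ →ₗ[ℝ] ℝ) (c : Fin n → C) :
    NCRow g ℓ →ₗ[ℝ] (Fin n → ℝ) where
  toFun r k := φ (ncMatAdj (c k).1 * r)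
  map_add' r s := by ext k; simp [Matrix.mul_add]
  map_smul' t r := by ext k; simp

/-- The Gelfand–Naimark–Segal construction for a functional on `C^* ℝ⟨x, x^*⟩_1 C`. -/
theorem exists_gns [FiniteDimensional ℝ C] (hC : IsRightChipSpace C)
    (hfull : IsFullChipSpace C) (φ : NCMat g ℓ ℓ →ₗ[ℝ] ℝ)
    (hsymm : ∀ f, φ (ncMatAdj f) = φ f)
    (hcross : ∀ r ∈ C, ∀ h ∈ J, h ∈ degOneMul C → φ (ncMatAdj r * h) = 0)
    (hpos : ∀ a ∈ C, 0 ≤ φ (ncMatAdj a * a))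
    (hzero : ∀ a ∈ C, φ (ncMatAdj a * a) = 0 → a ∈ J) :
    ∃ (n : ℕ) (X : Fin g → Matrix (Fin n) (Fin n) ℝ) (v : Fin ℓ × Fin n → ℝ),
      (∀ h ∈ J, h ∈ degOneMul C → rowVal X v h = 0) ∧
      (∀ f ∈ adjDegOneMul C, ncQuadLin X v f = φ f) ∧
      ∀ u : Fin n → ℝ, ∃ a ∈ C, rowVal X v a = u := by
  obtain ⟨n, c, hc, hres⟩ := exists_orthonormal_modulo_isotropic (B := functionalForm C φ)
    (fun x y => by
      change φ (ncMatAdj x.1 * y.1) = φ (ncMatAdj y.1 * x.1)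
      rw [← hsymm, ncMatAdj_mul, ncMatAdj_ncMatAdj]) (fun a => hpos a a.2)
  let Φ := functionalCoord φ c
  have hΦc : ∀ l k, Φ (c l).1 k = if k = l then 1 else 0 := fun l k => hc k l
  have hΦJ : ∀ h ∈ J, h ∈ degOneMul C → Φ h = 0 := fun h hJ hd =>
    funext fun k => hcross _ (c k).2 h hJ hd
  have hproj : ∀ a ∈ C, a - ∑ k, Φ a k • (c k).1 ∈ J := by
    intro a ha
    have h1 := hzero _ (Subtype.prop _) (hres ⟨a, ha⟩)
    rw [Submodule.coe_sub, Submodule.coe_sum] at h1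
    exact h1
  have hprojC : ∀ a ∈ C, a - ∑ k, Φ a k • (c k).1 ∈ C := fun a ha =>
    C.sub_mem ha (C.sum_mem fun k _ => C.smul_mem _ (c k).2)
  -- The compression of left multiplication by `x_i` to the span of the orthonormal family.
  let X : Fin g → Matrix (Fin n) (Fin n) ℝ := fun i =>
    Matrix.of fun k l => Φ ((FreeAlgebra.ι ℝ (Sum.inl i) : NCPoly g) • (c l).1) k
  have hX : ∀ (s : Fin g ⊕ Fin g) (k l : Fin n),
      ncEval X (FreeAlgebra.ι ℝ s) k l = Φ (FreeAlgebra.ι ℝ s • (c l).1) k := by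
    rintro (i | i) k l
    · simp [ncEval, X]
    · have h1 : ncEval X (FreeAlgebra.ι ℝ (Sum.inr i)) k l = X i l k := by simp [ncEval]
      rw [h1]
      change φ (ncMatAdj (c l).1 * ((FreeAlgebra.ι ℝ (Sum.inl i) : NCPoly g) • (c k).1)) = _
      rw [← hsymm, ncMatAdj_mul, ncMatAdj_ncMatAdj, ncMatAdj_smul_mul, ncAdj_letter]
      rfl
  -- Compression loses nothing on `C`: the residual of `a` lies in `J ∩ C`, so its product with a
  -- letter is in `J` and of allowed degree, and `Φ` kills it.
  have hlet : ∀ (s : Fin g ⊕ Fin g), ∀ a ∈ C,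
      ncEval X (FreeAlgebra.ι ℝ s) *ᵥ Φ a = Φ (FreeAlgebra.ι ℝ s • a) := by
    intro s a ha
    have h1 := hΦJ _ (J.smul_mem (FreeAlgebra.ι ℝ s) (hproj a ha))
      (smul_mem_degOneMul (letter_mem_ncDegLE_one s) (hprojC a ha))
    rw [smul_sub, map_sub, sub_eq_zero, Finset.smul_sum, map_sum] at h1
    rw [h1]
    ext k
    simp only [Matrix.mulVec, dotProduct, hX, Finset.sum_apply, smul_comm _ (_ : ℝ) (_ : NCRow g ℓ),
      map_smul, Pi.smul_apply, smul_eq_mul]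
    exact Finset.sum_congr rfl fun l _ => mul_comm _ _
  classical
  -- If `e_i ∉ C`, fullness keeps every `e_i ⊗ w` out of `C`, so the value `0` is harmless.
  let v : Fin ℓ × Fin n → ℝ := fun x =>
    if rowMonomial x.1 [] ∈ C then Φ (rowMonomial x.1 []) x.2 else 0
  have hmon : ∀ (i : Fin ℓ) (w : List (Fin g ⊕ Fin g)), rowMonomial i w ∈ C →
      rowVal X v (rowMonomial i w) = Φ (rowMonomial i w) := by
    intro i w
    induction w with
    | nil =>
      intro h
      ext k
      rw [rowVal_rowMonomial_nil]
      exact if_pos h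
    | cons s w ih =>
      intro h
      have hw : rowMonomial i w ∈ C := hfull i [s] w h
      rw [rowMonomial_cons, rowVal_smul, ih hw, hlet s _ hw]
  have hvalC : ∀ a ∈ C, rowVal X v a = Φ a := by
    obtain ⟨S, hS⟩ := hC.spanned
    intro a ha
    have hle : C ≤ LinearMap.eqLocus (rowVal X v) Φ := by
      conv_lhs => rw [hS]
      rw [Submodule.span_le]
      rintro _ ⟨m, hm, rfl⟩
      exact hmon m.1 m.2 (by rw [hS]; exact Submodule.subset_span ⟨m, hm, rfl⟩)
    exact hle ha
  have hvald : ∀ d ∈ degOneMul C, rowVal X v d = Φ d := by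
    intro d hd
    have hle : degOneMul C ≤ LinearMap.eqLocus (rowVal X v) Φ := by
      refine Submodule.span_le.2 ?_
      rintro _ ⟨x, hx, a, ha, rfl⟩
      change rowVal X v (x • a) = Φ (x • a)
      rw [rowVal_smul, hvalC a ha]
      induction hx using Submodule.span_induction with
      | mem x h =>
        obtain ⟨w, hw, rfl⟩ := h
        match w, hw with
        | [], _ => simp
        | [s], _ => simpa using hlet s a ha
      | zero => simp
      | add x y _ _ hx hy => rw [map_add, Matrix.add_mulVec, hx, hy, add_smul, map_add]
      | smul t x _ hx => rw [map_smul, Matrix.smul_mulVec, hx, smul_assoc, map_smul Φ t (x • a)]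
    exact hle hd
  refine ⟨n, X, v, fun h hJ hd => by rw [hvald h hd, hΦJ h hJ hd], fun f hf => ?_,
    fun u => ⟨∑ k, u k • (c k).1, C.sum_mem fun k _ => C.smul_mem _ (c k).2, ?_⟩⟩
  · have hle : adjDegOneMul C ≤ LinearMap.eqLocus (ncQuadLin X v) φ := by
      refine Submodule.span_le.2 ?_
      rintro _ ⟨b, hb, d, hd, rfl⟩
      change ncQuadLin X v (ncMatAdj b * d) = φ (ncMatAdj b * d)
      have h1 : ncQuadLin X v (ncMatAdj b * d) = rowVal X v b ⬝ᵥ rowVal X v d := by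
        rw [ncQuadLin_adj_mul]
        simp only [dotProduct, Fintype.sum_prod_type, Fin.sum_univ_one]
        rfl
      rw [h1, hvalC b hb, hvald d hd]
      -- The residual of `b` is orthogonal to `d` too: a degree-one factor `x` of `d` moves across
      -- as `x^*` onto the residual, giving a row of `J` of allowed degree.
      have h2 : φ (ncMatAdj d * (b - ∑ k, Φ b k • (c k).1)) = 0 := by
        have hle' : degOneMul C ≤ LinearMap.ker (φ ∘ₗ
            ({ toFun := fun d => ncMatAdj (b - ∑ k, Φ b k • (c k).1) * d
               map_add' := fun x y => Matrix.mul_add _ _ _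
               map_smul' := fun t x => Matrix.mul_smul _ _ _ } :
              NCRow g ℓ →ₗ[ℝ] NCMat g ℓ ℓ)) := by
          refine Submodule.span_le.2 ?_
          rintro _ ⟨x, hx, a, ha, rfl⟩
          change φ (ncMatAdj (b - ∑ k, Φ b k • (c k).1) * (x • a)) = 0
          rw [← hsymm, ncMatAdj_mul, ncMatAdj_ncMatAdj, ncMatAdj_smul_mul]
          have hx' : ncAdj x ∈ ncDegLE g 1 := by
            induction hx using Submodule.span_induction with
            | mem x h =>
              obtain ⟨w, hw, rfl⟩ := h
              match w, hw with
              | [], _ => simpa using one_mem_ncDegLE_one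
              | [s], _ => simpa using letter_mem_ncDegLE_one s.swap
            | zero => simp
            | add x y _ _ hx hy => rw [ncAdj_add]; exact add_mem hx hy
            | smul t x _ hx => rw [ncAdj_smul]; exact Submodule.smul_mem _ _ hx
          exact hcross a ha _ (J.smul_mem _ (hproj b hb))
            (smul_mem_degOneMul hx' (hprojC b hb))
        have := hle' hd
        rw [← hsymm, ncMatAdj_mul, ncMatAdj_ncMatAdj]
        exact this
      rw [Matrix.mul_sub, map_sub, sub_eq_zero] at h2
      rw [← hsymm, ncMatAdj_mul, ncMatAdj_ncMatAdj, h2, Matrix.mul_sum, map_sum]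
      refine Finset.sum_congr rfl fun k _ => ?_
      rw [Matrix.mul_smul, map_smul, smul_eq_mul, ← hsymm (ncMatAdj d * _), ncMatAdj_mul,
        ncMatAdj_ncMatAdj]
      rfl
    exact hle hf
  · rw [hvalC _ (C.sum_mem fun k _ => C.smul_mem _ (c k).2), map_sum]
    ext k
    simp [hΦc]

end GNS

/-! ### The dichotomy and the theorem -/

section Main

variable {g ν ℓ : ℕ} {C : Submodule ℝ (NCRow g ℓ)}

/-- The matrix polynomial with given rows in `C`. -/
def ofRows : (Fin ν → C) →ₗ[ℝ] NCMat g ν ℓ where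
  toFun q := Matrix.of fun i j => (q i).1 0 j
  map_add' _ _ := rfl
  map_smul' _ _ := rfl

@[simp] lemma ncRowOf_ofRows (q : Fin ν → C) (i : Fin ν) : ncRowOf (ofRows q) i = q i := by
  ext k j
  rw [Subsingleton.elim k 0]
  rfl

lemma memRows_ofRows (q : Fin ν → C) : MemRows C (ofRows q) := fun i => by
  change ncRowOf (ofRows q) i ∈ C
  rw [ncRowOf_ofRows]
  exact (q i).2

/-- The bilinear map whose diagonal values are `a^* a + q^* L q`. -/
def pencilPairing (C : Submodule ℝ (NCRow g ℓ)) (L : NCMat g ν ν) :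
    (C × (Fin ν → C)) →ₗ[ℝ] (C × (Fin ν → C)) →ₗ[ℝ] NCMat g ℓ ℓ :=
  LinearMap.mk₂ ℝ
    (fun x y => ncMatAdj x.1.1 * y.1.1 + ncMatAdj (ofRows x.2) * L * ofRows y.2)
    (fun x y z => by
      simp only [Prod.fst_add, Prod.snd_add, Submodule.coe_add, map_add, ncMatAdj_add,
        Matrix.add_mul]
      abel)
    (fun t x y => by
      simp only [Prod.smul_fst, Prod.smul_snd, Submodule.coe_smul, map_smul, ncMatAdj_smul,
        Matrix.smul_mul, smul_add])
    (fun x y z => by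
      simp only [Prod.fst_add, Prod.snd_add, Submodule.coe_add, map_add, Matrix.mul_add]
      abel)
    (fun t x y => by
      simp only [Prod.smul_fst, Prod.smul_snd, Submodule.coe_smul, map_smul,
        Matrix.mul_smul, smul_add])

lemma pencilPairing_apply (L : NCMat g ν ν) (x y : C × (Fin ν → C)) :
    pencilPairing C L x y =
      ncMatAdj x.1.1 * y.1.1 + ncMatAdj (ofRows x.2) * L * ofRows y.2 := rfl

lemma ncMatAdj_pencilPairing {L : NCMat g ν ν} (hL : ncMatAdj L = L)
    (x y : C × (Fin ν → C)) :
    ncMatAdj (pencilPairing C L x y) = pencilPairing C L y x := by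
  simp [pencilPairing_apply, ncMatAdj_add, ncMatAdj_mul, hL, Matrix.mul_assoc]

/-- If `f` has no certificate relative to `J`, then there is a point at which it is negative. -/
theorem hasCertificate_or_exists_neg {L : NCMat g ν ν} (hL : IsLinearPencil L)
    (hC : IsRightChipSpace C) (hfull : IsFullChipSpace C) [FiniteDimensional ℝ C]
    {J : Submodule (NCPoly g) (NCRow g ℓ)} (K : Submodule ℝ (C × (Fin ν → C)))
    (hK : ∀ x ∈ K, x.1.1 ∈ J ∧ MemRows (realSpace J) (L * ofRows x.2))
    (hreal : ∀ (n : ℕ) (x : Fin n → C × (Fin ν → C)),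
      MemSymmSum J (∑ i, pencilPairing C L (x i) (x i)) → ∀ i, x i ∈ K)
    {f : NCMat g ℓ ℓ} (hf : f ∈ adjDegOneMul C) (hfsymm : ncMatAdj f = f) :
    HasCertificate L C J f ∨
      ∃ (n : ℕ) (X : Fin g → Matrix (Fin n) (Fin n) ℝ) (v : Fin ℓ × Fin n → ℝ),
        (∀ h ∈ J, h ∈ degOneMul C → rowVal X v h = 0) ∧
        v ⬝ᵥ (ncMatEval X f *ᵥ v) < 0 ∧ (ncMatEval X L).PosSemidef ∧
        ((∀ q, (0, q) ∈ K → MemRows (realSpace J) (ofRows q)) →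
          (ncMatEval X L).PosDef) := by
  by_cases hcert : HasCertificate L C J f
  · exact Or.inl hcert
  right
  have hr : ∀ k ∈ K, ∀ x, pencilPairing C L x k ∈ crossSpan C J := by
    intro k hk x
    rw [pencilPairing_apply, Matrix.mul_assoc]
    refine add_mem (Submodule.subset_span
      ⟨_, x.1.2, _, (hK k hk).1, mem_degOneMul_of_mem k.1.2, rfl⟩) ?_
    exact adj_mul_mem_crossSpan (memRows_ofRows _)
      (memRows_degOneMul_mul hL.deg_le_one (memRows_ofRows _)) (hK k hk).2
  obtain ⟨φ₀, hU, hpos₀, hneg₀⟩ := exists_separating (B := pencilPairing C L) (K := K)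
    (U := symmCrossSpan C J) (p := f)
    (fun k hk x => by
      rw [← ncMatAdj_pencilPairing hL.symm]
      exact adj_mem_symmCrossSpan (hr k hk x))
    (fun k hk x => crossSpan_le_symmCrossSpan (hr k hk x))
    (fun n x h => hreal n x (memSymmSum_of_mem_symmCrossSpan h))
    (fun n x h => hcert (hasCertificate_of_sub_mem hL.symm hfsymm (fun i => (x i).1.2)
      (fun i => memRows_ofRows (x i).2) h))
  -- Symmetrising makes the GNS form symmetric. Positivity off `K`, vanishing on cross terms and the
  -- sign at the symmetric `f` all survive.
  let φ : NCMat g ℓ ℓ →ₗ[ℝ] ℝ := φ₀ + φ₀ ∘ₗ ncMatAdjLin g ℓ ℓ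
  have hφ : ∀ h, φ h = φ₀ h + φ₀ (ncMatAdj h) := fun h => rfl
  have hpos : ∀ x ∉ K, 0 < φ (pencilPairing C L x x) := fun x hx => by
    rw [hφ, ncMatAdj_pencilPairing hL.symm]
    exact add_pos (hpos₀ x hx) (hpos₀ x hx)
  have hcr : ∀ u ∈ crossSpan C J, φ u = 0 := fun u hu => by
    rw [hφ, hU _ (crossSpan_le_symmCrossSpan hu), hU _ (adj_mem_symmCrossSpan hu), add_zero]
  have hnonneg : ∀ x, 0 ≤ φ (pencilPairing C L x x) := fun x => by
    by_cases hx : x ∈ K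
    · rw [hcr _ (hr x hx x)]
    · exact (hpos x hx).le
  have hleft : ∀ a : C, pencilPairing C L (a, 0) (a, 0) = ncMatAdj a.1 * a.1 := fun a => by
    simp [pencilPairing_apply]
  have hright : ∀ q : Fin ν → C, pencilPairing C L (0, q) (0, q) =
      ncMatAdj (ofRows q) * L * ofRows q := fun q => by
    simp [pencilPairing_apply]
  obtain ⟨n, X, v, hJ, hval, hsurj⟩ := exists_gns (J := J) hC hfull φ
    (fun h => by rw [hφ, hφ, ncMatAdj_ncMatAdj, add_comm])
    (fun r hrC h hhJ hd => hcr _ (Submodule.subset_span ⟨r, hrC, h, hhJ, hd, rfl⟩))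
    (fun a ha => hleft ⟨a, ha⟩ ▸ hnonneg _)
    (fun a ha h0 => by
      by_contra hna
      refine (hpos (⟨a, ha⟩, 0) fun h => hna (hK _ h).1).ne' ?_
      rw [hleft]
      exact h0)
  have hherm : (ncMatEval X L).IsHermitian := by
    rw [Matrix.IsHermitian, Matrix.conjTranspose_eq_transpose_of_trivial, ← ncMatEval_ncMatAdj,
      hL.symm]
  -- Cyclicity of `v`: any `u` is `q(X) v` with rows of `q` in `C`, which identifies the form of
  -- `L(X)` with `φ (q^* L q)`.
  have hvec : ∀ u : Fin ν × Fin n → ℝ, ∃ q : Fin ν → C,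
      ncMatEval X (ofRows q) *ᵥ v = u ∧
        u ⬝ᵥ (ncMatEval X L *ᵥ u) = φ (pencilPairing C L (0, q) (0, q)) := by
    intro u
    choose a haC ha using fun i => hsurj fun k => u (i, k)
    refine ⟨fun i => ⟨a i, haC i⟩, ?_⟩
    have h1 : ncMatEval X (ofRows fun i => (⟨a i, haC i⟩ : C)) *ᵥ v = u := by
      ext ⟨i, k⟩
      rw [ncMatEval_mulVec_apply, ncRowOf_ofRows, ha]
    refine ⟨h1, ?_⟩
    rw [hright, ← hval, ncQuadLin_adj_mul_mul, h1]
    rw [Matrix.mul_assoc]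
    exact adj_mul_mem_adjDegOneMul (memRows_ofRows _)
      (memRows_degOneMul_mul hL.deg_le_one (memRows_ofRows _))
  refine ⟨n, X, v, hJ, ?_, ?_, fun hstrong => ?_⟩
  · rw [← ncQuadLin_apply, hval f hf, hφ, hfsymm]
    linarith
  · refine Matrix.PosSemidef.of_dotProduct_mulVec_nonneg hherm fun u => ?_
    obtain ⟨q, -, hq⟩ := hvec u
    rw [star_trivial, hq]
    exact hnonneg _
  · refine Matrix.PosDef.of_dotProduct_mulVec_pos hherm fun u hu => ?_
    obtain ⟨q, hqu, hq⟩ := hvec u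
    rw [star_trivial, hq]
    -- Were `(0, q)` degenerate, the rows of `q` would lie in `J`, forcing `u = q(X) v = 0`.
    refine hpos _ fun hqK => hu ?_
    rw [← hqu, ncMatEval_mulVec_eq_zero_iff]
    intro i
    refine hJ _ (hstrong q hqK i) (mem_degOneMul_of_mem ?_)
    exact memRows_ofRows q i

/-- The functional controls only rows of `J` of bounded degree. That suffices because the generators
of `I` have such degree and the annihilator is a left module. -/
lemma memZeroSet_of_generators {n : ℕ} {X : Fin g → Matrix (Fin n) (Fin n) ℝ}
    {v : Fin ℓ × Fin n → ℝ} {I J : Submodule (NCPoly g) (NCRow g ℓ)} {S : Set (NCRow g ℓ)}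
    (hS : S ⊆ (degOneMul C : Set (NCRow g ℓ))) (hI : I = Submodule.span (NCPoly g) S)
    (hIJ : I ≤ J) (hJ : ∀ h ∈ J, h ∈ degOneMul C → rowVal X v h = 0) :
    MemZeroSet I X v := by
  rw [memZeroSet_iff]
  conv_lhs => rw [hI]
  refine Submodule.span_le.2 fun h hh => hJ h (hIJ ?_) (hS hh)
  rw [hI]
  exact Submodule.subset_span hh

/-- The pairs whose first row and all rows of whose second entry, multiplied by `M`, lie in `J`. -/
def degeneratePairs (C : Submodule ℝ (NCRow g ℓ)) (M : NCMat g ν ν)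
    (J : Submodule (NCPoly g) (NCRow g ℓ)) : Submodule ℝ (C × (Fin ν → C)) where
  carrier := {x | x.1.1 ∈ J ∧ MemRows (realSpace J) (M * ofRows x.2)}
  zero_mem' := ⟨J.zero_mem, by
    rw [Prod.snd_zero, map_zero, Matrix.mul_zero]
    exact fun i => J.zero_mem⟩
  add_mem' {x y} hx hy := ⟨J.add_mem hx.1 hy.1, by
    rw [Prod.snd_add, map_add, Matrix.mul_add]
    exact fun i => J.add_mem (hx.2 i) (hy.2 i)⟩
  smul_mem' t x hx := ⟨(realSpace J).smul_mem t hx.1, by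
    rw [Prod.smul_snd, map_smul, Matrix.mul_smul]
    exact fun i => (realSpace J).smul_mem t (hx.2 i)⟩

lemma mem_degeneratePairs {M : NCMat g ν ν} {J : Submodule (NCPoly g) (NCRow g ℓ)}
    {x : C × (Fin ν → C)} : x ∈ degeneratePairs C M J ↔
      x.1.1 ∈ J ∧ MemRows (realSpace J) (M * ofRows x.2) := Iff.rfl

lemma memRows_mul {J : Submodule (NCPoly g) (NCRow g ℓ)} (L : NCMat g ν ν) {q : NCMat g ν ℓ}
    (hq : MemRows (realSpace J) q) : MemRows (realSpace J) (L * q) := by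
  intro i
  change ncRowOf (L * q) i ∈ J
  rw [ncRowOf_mul]
  exact J.sum_mem fun j _ => J.smul_mem _ (hq j)

end Main

end

theorem theorem1p6 {g ν ℓ : ℕ}
    (L : NCMat g ν ν) (hL : IsLinearPencil L)
    (C : Submodule ℝ (NCRow g ℓ)) (hC : IsRightChipSpace C) (hCfull : IsFullChipSpace C)
    (hCfin : FiniteDimensional ℝ C)
    (I : Submodule (NCPoly g) (NCRow g ℓ))
    (hI : ∃ S : Set (NCRow g ℓ), S ⊆ (degOneMul C : Set (NCRow g ℓ)) ∧
      I = Submodule.span (NCPoly g) S)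
    (p : NCMat g ℓ ℓ) (hp : p ∈ adjDegOneMul C) (hpsymm : ncMatAdj p = p) :
    ((∀ (n : ℕ) (X : Fin g → Matrix (Fin n) (Fin n) ℝ) (v : Fin ℓ × Fin n → ℝ),
        MemZeroSet I X v → (ncMatEval X L).PosSemidef → 0 ≤ v ⬝ᵥ (ncMatEval X p *ᵥ v)) ↔
      HasCertificate L C (lcRadical L C I) p) ∧
    ((∀ (n : ℕ) (X : Fin g → Matrix (Fin n) (Fin n) ℝ) (v : Fin ℓ × Fin n → ℝ),
        MemZeroSet I X v → (ncMatEval X L).PosDef → 0 ≤ v ⬝ᵥ (ncMatEval X p *ᵥ v)) ↔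
      HasCertificate L C (lcStrongRadical L C I) p) := by
  have hsum : ∀ (J : Submodule (NCPoly g) (NCRow g ℓ)) (n : ℕ) (x : Fin n → C × (Fin ν → C)),
      MemSymmSum J (∑ i, pencilPairing C L (x i) (x i)) →
      MemSymmSum J (∑ i, ncMatAdj (x i).1.1 * (x i).1.1 +
        ∑ i, ncMatAdj (ofRows (x i).2) * L * ofRows (x i).2) := fun J n x h => by
    rwa [← Finset.sum_add_distrib]
  obtain ⟨S, hS, hIS⟩ := hI
  constructor
  · constructor
    · intro h
      refine (hasCertificate_or_exists_neg hL hC hCfull (degeneratePairs C L (lcRadical L C I))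
        (fun x hx => hx) (fun n x hx i => ?_) hp hpsymm).resolve_right ?_
      · have := isLCReal_lcRadical L C I n n _ _ (fun i => (x i).1.2)
          (fun i => memRows_ofRows (x i).2) (hsum _ n x hx)
        exact ⟨this.1 i, this.2 i⟩
      · rintro ⟨n, X, v, hJ, hneg, hpsd, -⟩
        exact hneg.not_ge (h n X v
          (memZeroSet_of_generators hS hIS (le_lcRadical L C I) hJ) hpsd)
    · intro h n X v hv hpsd
      exact nonneg_of_hasCertificate X v hpsd
        (show lcRadical L C I ≤ annihilator X v from
          sInf_le ⟨(memZeroSet_iff X v I).1 hv, isLCReal_annihilator X v hpsd⟩) h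
  · constructor
    · intro h
      refine (hasCertificate_or_exists_neg hL hC hCfull
        -- Taking `M = 1` instead of `L` encodes the strong notion: degenerate pairs have `q` itself
        -- in `J`, which yields definiteness of `L(X)`.
        (degeneratePairs C 1 (lcStrongRadical L C I)) (fun x hx => ?_)
        (fun n x hx i => ?_) hp hpsymm).resolve_right ?_
      · rw [mem_degeneratePairs, Matrix.one_mul] at hx
        exact ⟨hx.1, memRows_mul L hx.2⟩
      · have := isStronglyLCReal_lcStrongRadical L C I n n _ _ (fun i => (x i).1.2)
          (fun i => memRows_ofRows (x i).2) (hsum _ n x hx)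
        rw [mem_degeneratePairs, Matrix.one_mul]
        exact ⟨this.1 i, this.2 i⟩
      · rintro ⟨n, X, v, hJ, hneg, -, hpd⟩
        refine hneg.not_ge (h n X v
          (memZeroSet_of_generators hS hIS (le_lcStrongRadical L C I) hJ) (hpd fun q hq => ?_))
        rw [mem_degeneratePairs, Matrix.one_mul] at hq
        exact hq.2
    · intro h n X v hv hpd
      exact nonneg_of_hasCertificate X v hpd.posSemidef
        (show lcStrongRadical L C I ≤ annihilator X v from
          sInf_le ⟨(memZeroSet_iff X v I).1 hv, isStronglyLCReal_annihilator X v hpd⟩) h
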